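/- Let $f:\mathbb R^n\to\mathbb R^n$ and $g:\mathbb R^n\to\mathbb R^{n\times m}$ be smooth ($C^\infty$), let $g_j$ be the $j$-th column of $g$, and consider the control-affine system $\dot x=f(x)+g(x)u$. Let $H$ be a smooth map from $\mathbb R^n$ to the real symmetric $p\times p$ matrices. Lie derivatives $\mathbf L_v M(x)$ of matrix-valued functions are taken entrywise. An extended class-$\mathcal K^e$ function is a continuous, strictly increasing $\alpha:\mathbb R\to\mathbb R$ with $\alpha(0)=0$; it is applied spectrally to a symmetric matrix, giving $\boldsymbol\alpha(U\operatorname{diag}(\lambda_i)U^\top)=U\operatorname{diag}(\alpha(\lambda_i))U^\top$ for orthogonal $U$. Let $r\ge 1$, let $\alpha_1,\dots,\alpha_{r-1}$ be smooth extended class-$\mathcal K^e$ functions, and put $$\Psi_1=H,\qquad \Psi_{i+1}=\mathbf L_f\Psi_i+\boldsymbol\alpha_i(\Psi_i)\quad(1\le i\le r-1),$$ where $r$ is the first level at which the input acts: $\mathbf L_{g_j}\Psi_i\equiv 0$ for all $j$ and all $i<r$, while $\mathbf L_{g_j}\Psi_r\not\equiv 0$ for some $j$. Put $\mathcal C_i=\{x\in\mathbb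 R^n:\Psi_i(x)\succeq 0\}$, $\mathcal C=\bigcap_{i=1}^r\mathcal C_i$ and $$\dot\Psi_r(x,u)=\mathbf L_f\Psi_r(x)+\sum_{j=1}^m \mathbf L_{g_j}\Psi_r(x)\,u_j .$$ Suppose that $H$ is a high-order matrix control barrier function with top-level extended class-$\mathcal K^e$ function $\alpha_r$, that is, for each $x\in\mathcal C$ there is $u\in\mathbb R^m$ with $\dot\Psi_r(x,u)\succ-\boldsymbol\alpha_r(\Psi_r(x))$. A set $S\subseteq\mathbb R^n$ is called forward invariant for $\dot x=F(x)$ if every solution $x(t)$, on an interval starting at $t=0$, with $x(0)\in S$ satisfies $x(t)\in S$ for all $t\ge 0$ in that interval. Then: 1. If $k:\mathbb R^n\to\mathbb R^m$ is continuous and $\dot\Psi_r(x,k(x))\succeq-\boldsymbol\alpha_r(\Psi_r(x))$ for all $x$ in some open neighborhood of $\mathcal C$, then $\mathcal C$ is forward invariant for the closed-loop system $\dot x=f(x)+g(x)k(x)$. 2. Let $k_{\mathrm{nom}}:\mathbb R^n\to\mathbb R^m$ be continuous. Then there is an open neighborhood $\mathcal E$ of $\mathcal C$ such that for every $x\in\mathcal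 E$ the CBF-SDP $$\min_{u\in\mathbb R^m}\ \|u-k_{\mathrm{nom}}(x)\|^2\quad\text{subject to}\quad \dot\Psi_r(x,u)\succeq-\boldsymbol\alpha_r(\Psi_r(x))$$ has exactly one minimizer $k(x)$, the controller $x\mapsto k(x)$ is continuous on $\mathcal E$, and $\mathcal C$ is forward invariant for $\dot x=f(x)+g(x)k(x)$, whatever values are assigned to $k$ outside $\mathcal E$. -/

import Mathlib

open scoped ContDiff Matrix

noncomputable section

/-- The state space and the input space: `d`-dimensional Euclidean space. -/
abbrev Vec (d : ℕ) : Type := EuclideanSpace ℝ (Fin d)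

/-- Real square matrices of size `p`. -/
abbrev Mat (p : ℕ) : Type := Matrix (Fin p) (Fin p) ℝ

/-- Extended class-K functions: continuous, strictly increasing on `ℝ` and zero at zero. -/
structure IsExtendedClassK (a : ℝ → ℝ) : Prop where
  continuous : Continuous a
  strictMono : StrictMono a
  map_zero : a 0 = 0

/-- The spectral extension of a scalar function to symmetric matrices: for
`A = U diag(l₁, …, l_p) Uᵀ` with `U` orthogonal, it is `U diag(a l₁, …, a l_p) Uᵀ`. -/
def spectralMap {p : ℕ} (a : ℝ → ℝ) (A : Mat p) : Mat p := cfc a A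

/-- The entrywise Lie derivative of a matrix-valued function along a vector field. -/
def matLie {n p : ℕ} (v : Vec n → Vec n) (M : Vec n → Mat p) (x : Vec n) : Mat p :=
  Matrix.of fun a b => fderiv ℝ (fun y => M y a b) x (v x)

/-- The `j`-th column of the control matrix, as a vector field. -/
def ctrlCol {n m : ℕ} (g : Vec n → Matrix (Fin n) (Fin m) ℝ) (j : Fin m) (x : Vec n) : Vec n :=
  WithLp.toLp 2 fun i => g x i j

/-- The closed-loop vector field `f(x) + g(x) k(x)` of the state feedback `u = k(x)`. -/
def closedLoop {n m : ℕ} (f : Vec n → Vec n) (g : Vec n → Matrix (Fin n) (Fin m) ℝ)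
    (k : Vec n → Vec m) (x : Vec n) : Vec n :=
  f x + WithLp.toLp 2 (g x *ᵥ (k x).ofLp)

/-- The sequence `Ψ₁ = H`, `Ψ_{i+1} = L_f Ψ_i + α_i(Ψ_i)`. Indices start at one, as in the
mathematical notation; the entry at index zero is never used. -/
def barrierSeq {n p : ℕ} (f : Vec n → Vec n) (H : Vec n → Mat p) (α : ℕ → ℝ → ℝ) :
    ℕ → Vec n → Mat p
  | 0 => fun _ => 0
  | 1 => H
  | i + 2 => fun x =>
      matLie f (barrierSeq f H α (i + 1)) x + spectralMap (α (i + 1)) (barrierSeq f H α (i + 1) x)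

/-- The intersection of the sets `C_i = {x | Ψ_i(x) ⪰ 0}` over `1 ≤ i ≤ r`. -/
def safeSet {n p : ℕ} (f : Vec n → Vec n) (H : Vec n → Mat p) (α : ℕ → ℝ → ℝ) (r : ℕ) :
    Set (Vec n) :=
  {x | ∀ i, 1 ≤ i → i ≤ r → (barrierSeq f H α i x).PosSemidef}

/-- `r` is the first level (counted from one) at which some input direction acts on the derivative
of `Ψ_r`, i.e. at which `L_{g_j} Ψ_r` is not identically zero for some `j`. -/
structure IsFirstInputLevel {n m p : ℕ} (f : Vec n → Vec n)
    (g : Vec n → Matrix (Fin n) (Fin m) ℝ) (H : Vec n → Mat p) (α : ℕ → ℝ → ℝ) (r : ℕ) : Prop where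
  one_le : 1 ≤ r
  lower : ∀ i, 1 ≤ i → i < r → ∀ j x, matLie (ctrlCol g j) (barrierSeq f H α i) x = 0
  top : ∃ j x, matLie (ctrlCol g j) (barrierSeq f H α r) x ≠ 0

/-- `Ψ̇_r(x, u) = L_f Ψ_r(x) + ∑ j, u_j L_{g_j} Ψ_r(x)`. -/
def barrierDot {n m p : ℕ} (f : Vec n → Vec n) (g : Vec n → Matrix (Fin n) (Fin m) ℝ)
    (H : Vec n → Mat p) (α : ℕ → ℝ → ℝ) (r : ℕ) (x : Vec n) (u : Vec m) : Mat p :=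
  matLie f (barrierSeq f H α r) x + ∑ j, u j • matLie (ctrlCol g j) (barrierSeq f H α r) x

/-- `H` is a high-order matrix control barrier function, `αr` being a top-level extended class-K
function as its definition asks for: at every point of the safe set some input satisfies the strict
inequality `Ψ̇_r(x, u) ≻ -αr(Ψ_r(x))`. -/
structure IsHOMCBFWith {n m p : ℕ} (f : Vec n → Vec n) (g : Vec n → Matrix (Fin n) (Fin m) ℝ)
    (H : Vec n → Mat p) (α : ℕ → ℝ → ℝ) (r : ℕ) (αr : ℝ → ℝ) : Prop where
  classK : IsExtendedClassK αr
  strict : ∀ x ∈ safeSet f H α r, ∃ u : Vec m,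
    (barrierDot f g H α r x u - -spectralMap αr (barrierSeq f H α r x)).PosDef

/-- The inputs `u` with `Ψ̇_r(x, u) ⪰ -αr(Ψ_r(x))`. -/
def admissibleInputs {n m p : ℕ} (f : Vec n → Vec n) (g : Vec n → Matrix (Fin n) (Fin m) ℝ)
    (H : Vec n → Mat p) (α : ℕ → ℝ → ℝ) (r : ℕ) (αr : ℝ → ℝ) (x : Vec n) : Set (Vec m) :=
  {u | (barrierDot f g H α r x u - -spectralMap αr (barrierSeq f H α r x)).PosSemidef}

/-- `u` solves, at the state `x`, the semidefinite program: minimize `‖u - knom(x)‖²` subject to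
`Ψ̇_r(x, u) ⪰ -αr(Ψ_r(x))`. -/
def IsSDPSolution {n m p : ℕ} (f : Vec n → Vec n) (g : Vec n → Matrix (Fin n) (Fin m) ℝ)
    (H : Vec n → Mat p) (α : ℕ → ℝ → ℝ) (r : ℕ) (αr : ℝ → ℝ) (knom : Vec n → Vec m)
    (x : Vec n) (u : Vec m) : Prop :=
  u ∈ admissibleInputs f g H α r αr x ∧
    ∀ w ∈ admissibleInputs f g H α r αr x, ‖u - knom x‖ ^ 2 ≤ ‖w - knom x‖ ^ 2

/-- Every trajectory of `ẋ = F(x)` that starts in `C` stays in `C` as long as it exists.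
(A trajectory on a half-open interval is covered through its restrictions to `[0, T]`.) -/
def IsForwardInvariantFor {n : ℕ} (F : Vec n → Vec n) (C : Set (Vec n)) : Prop :=
  ∀ (T : ℝ) (x : ℝ → Vec n), x 0 ∈ C →
    IsIntegralCurveOn x (fun _ => F) (Set.Icc 0 T) →
    ∀ t ∈ Set.Icc 0 T, x t ∈ C

end

/-! Invariance is a comparison argument along a trajectory, run down the levels. If `P' + φ(P) ⪰ 0`,
`P 0 ⪰ 0` and `φ < 0` on negatives, then `P` stays positive semidefinite: a negative minimum of `vᵀ
P(t) v` over times and unit vectors occurs at an eigenvector and forces a positive time derivative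
there, contradicting minimality (`posSemidef_of_differential_inequality`). The constraint gives this
inequality for `Ψ_r`; then `Ψ_{i+1} ⪰ 0` is the same inequality for `Ψ_i`, because the input does
not enter below level `r`.

These derivatives exist only if the spectral map of a smooth scalar function is smooth on symmetric
matrices, even where eigenvalues cross (`contDiff_spectralMap`). Expand the function in a Fourier
series with rapidly decaying coefficients: `φ(M) = ∑ c_n exp(n z M)` with `z` imaginary. The
exponentials are unitary and their `k`-th derivatives grow only like `|n|^k`, so the series can be
differentiated termwise.

For the SDP, let `E` be the set of states where the strict inequality is solvable. Existence and
uniqueness are projection onto a closed convex set; continuity follows from the closed graph of the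
constraint and Slater's condition (`continuousOn_of_isMinOn_norm_sub`). -/

/-! ### Derivatives of powers and of unitary exponentials -/

/-- Apply Leibniz to `W ^ n * W`. Since `‖W‖ ≤ 1`, the term with all derivatives on `W ^ n` does not
grow, and the others are of lower order in `W ^ n`; each of the `n` factors thus adds at most a
multiple of `(n + 1) ^ (k - 1)`. -/
theorem exists_bound_iteratedFDeriv_pow {E A : Type*} [NormedAddCommGroup E] [NormedSpace ℝ E]
    [NormedRing A] [NormedAlgebra ℝ A] {W : E → A} (hW : ContDiff ℝ ∞ W) (h1 : ∀ x, ‖W x‖ ≤ 1)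
    (hb : ∀ k : ℕ, ∃ D : ℝ, ∀ x, ‖iteratedFDeriv ℝ k W x‖ ≤ D) (k : ℕ) :
    ∃ C : ℝ, 0 ≤ C ∧ ∀ (n : ℕ) (x : E),
      ‖iteratedFDeriv ℝ k (fun y => W y ^ n) x‖ ≤ C * ((n : ℝ) + 1) ^ k := by
  choose D hD using hb
  induction k using Nat.strong_induction_on with
  | _ k ih =>
    rcases Nat.eq_zero_or_pos k with rfl | hk
    -- The case `n = 0` needs `‖1‖`, which a normed ring does not bound by one.
    · refine ⟨max ‖(1 : A)‖ 1, by positivity, fun n x => ?_⟩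
      rw [norm_iteratedFDeriv_zero, pow_zero, mul_one]
      rcases Nat.eq_zero_or_pos n with rfl | hn
      · simp
      · exact (norm_pow_le' _ hn).trans ((pow_le_one₀ (norm_nonneg _) (h1 x)).trans (le_max_right _ _))
    · obtain ⟨k, rfl⟩ : ∃ l, k = l + 1 := ⟨k - 1, by omega⟩
      have ih' : ∀ i : ℕ, ∃ C : ℝ, 0 ≤ C ∧ (i < k + 1 → ∀ (n : ℕ) (x : E),
          ‖iteratedFDeriv ℝ i (fun y => W y ^ n) x‖ ≤ C * ((n : ℝ) + 1) ^ i) := by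
        intro i
        by_cases hi : i < k + 1
        · obtain ⟨C, h0, hC⟩ := ih i hi
          exact ⟨C, h0, fun _ => hC⟩
        · exact ⟨0, le_rfl, fun h => absurd h hi⟩
      choose C hC0 hC using ih'
      have hD0 : ∀ i, 0 ≤ D i := fun i => (norm_nonneg _).trans (hD i 0)
      -- `S` collects the Leibniz terms in which at least one derivative falls on the last factor.
      set S : ℝ := ∑ i ∈ Finset.range (k + 1), ((k + 1).choose i : ℝ) * C i * D (k + 1 - i) with hS
      have hS0 : 0 ≤ S := Finset.sum_nonneg fun i _ =>
        mul_nonneg (mul_nonneg (by positivity) (hC0 i)) (hD0 _)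
      have key : ∀ (n : ℕ) (x : E),
          ‖iteratedFDeriv ℝ (k + 1) (fun y => W y ^ n) x‖ ≤ n * (S * ((n : ℝ) + 1) ^ k) := by
        intro n x
        induction n with
        | zero => simp [iteratedFDeriv_succ_const]
        | succ n hn =>
          simp_rw [pow_succ (W _) n]
          refine (norm_iteratedFDeriv_mul_le (hW.pow n) hW x
            (n := k + 1) (by exact_mod_cast le_top)).trans ?_
          rw [Finset.sum_range_succ]
          have e1 : ∑ i ∈ Finset.range (k + 1), ((k + 1).choose i : ℝ) *
              ‖iteratedFDeriv ℝ i (fun y => W y ^ n) x‖ * ‖iteratedFDeriv ℝ (k + 1 - i) W x‖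
              ≤ S * ((n : ℝ) + 1) ^ k := by
            rw [hS, Finset.sum_mul]
            refine Finset.sum_le_sum fun i hi => ?_
            have hi' := Finset.mem_range.1 hi
            calc ((k + 1).choose i : ℝ) * ‖iteratedFDeriv ℝ i (fun y => W y ^ n) x‖ *
                    ‖iteratedFDeriv ℝ (k + 1 - i) W x‖
                ≤ ((k + 1).choose i : ℝ) * (C i * ((n : ℝ) + 1) ^ k) * D (k + 1 - i) := by
                  have h2 : ((n : ℝ) + 1) ^ i ≤ ((n : ℝ) + 1) ^ k :=
                    pow_le_pow_right₀ (by linarith [(Nat.cast_nonneg n : (0:ℝ) ≤ n)]) (by omega)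
                  have h3 := (hC i hi' n x).trans (mul_le_mul_of_nonneg_left h2 (hC0 i))
                  have h4 : 0 ≤ C i * ((n : ℝ) + 1) ^ k := mul_nonneg (hC0 i) (by positivity)
                  gcongr
                  exact hD _ _
              _ = _ := by ring
          have e2 : ‖iteratedFDeriv ℝ (k + 1) (fun y => W y ^ n) x‖ *
              ‖iteratedFDeriv ℝ 0 W x‖ ≤ n * (S * ((n : ℝ) + 1) ^ k) := by
            rw [norm_iteratedFDeriv_zero]
            exact (mul_le_of_le_one_right (norm_nonneg _) (h1 x)).trans hn
          have e3 : ((n : ℝ) + 1) ^ k ≤ ((n : ℝ) + 1 + 1) ^ k := by gcongr; linarith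
          have e4 := mul_le_mul_of_nonneg_left e3 hS0
          simp only [Nat.choose_self, Nat.cast_one, one_mul]
          rw [Nat.sub_self]
          push_cast
          have hn0 : (0 : ℝ) ≤ n := Nat.cast_nonneg n
          nlinarith [mul_le_mul_of_nonneg_left e4 hn0]
      refine ⟨S, hS0, fun n x => (key n x).trans ?_⟩
      rw [pow_succ]
      have : 0 ≤ S * ((n : ℝ) + 1) ^ k := by positivity
      nlinarith

theorem norm_exp_le_one_of_star_eq_neg {A : Type*} [CStarAlgebra A] {a : A} (ha : star a = -a) :
    ‖NormedSpace.exp a‖ ≤ 1 := by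
  let +nondep : NormedAlgebra ℚ A := .restrictScalars ℚ ℂ A
  have h : star (NormedSpace.exp a) * NormedSpace.exp a = 1 := by
    rw [NormedSpace.star_exp, ha,
      ← NormedSpace.exp_add_of_commute (Commute.neg_left (Commute.refl a))]
    simp
  have h2 := CStarRing.norm_star_mul_self (x := NormedSpace.exp a)
  rw [h] at h2
  rcases subsingleton_or_nontrivial A with hA | hA
  · rw [Subsingleton.elim (NormedSpace.exp a) 0]; simp
  · rw [CStarRing.norm_one] at h2
    nlinarith [norm_nonneg (NormedSpace.exp a)]

theorem contDiff_normedSpace_exp {A : Type*} [NormedRing A] [NormedAlgebra ℝ A] [CompleteSpace A] :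
    ContDiff ℝ ∞ (NormedSpace.exp : A → A) :=
  contDiff_iff_contDiffAt.2 fun x => (NormedSpace.exp_analytic (𝕂 := ℝ) x).contDiffAt

/-- Here `exp (n • B) = (exp B) ^ n`, with `exp B` unitary; negative `n` are handled through `-B`.
-/
theorem exists_bound_iteratedFDeriv_exp_zsmul {E A : Type*} [NormedAddCommGroup E]
    [NormedSpace ℝ E] [CStarAlgebra A] {B : E → A} (hB : ContDiff ℝ ∞ B)
    (hc : HasCompactSupport B) (hs : ∀ x, star (B x) = -B x) (k : ℕ) :
    ∃ C : ℝ, 0 ≤ C ∧ ∀ (n : ℤ) (x : E),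
      ‖iteratedFDeriv ℝ k (fun y => NormedSpace.exp (n • B y)) x‖ ≤ C * (|(n : ℝ)| + 1) ^ k := by
  have main : ∀ B : E → A, ContDiff ℝ ∞ B → HasCompactSupport B → (∀ x, star (B x) = -B x) →
      ∃ C : ℝ, 0 ≤ C ∧ ∀ (n : ℕ) (x : E),
      ‖iteratedFDeriv ℝ k (fun y => NormedSpace.exp (n • B y)) x‖ ≤ C * ((n : ℝ) + 1) ^ k := by
    intro B hB hc hs
    have hW : ContDiff ℝ ∞ (fun x => NormedSpace.exp (B x)) := contDiff_normedSpace_exp.comp hB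
    have h1 : ∀ x, ‖NormedSpace.exp (B x)‖ ≤ 1 := fun x => norm_exp_le_one_of_star_eq_neg (hs x)
    let +nondep : NormedAlgebra ℚ A := .restrictScalars ℚ ℂ A
    simp_rw [NormedSpace.exp_nsmul]
    refine exists_bound_iteratedFDeriv_pow hW h1 (fun j => ?_) k
    rcases Nat.eq_zero_or_pos j with rfl | hj
    · exact ⟨1, fun x => by rw [norm_iteratedFDeriv_zero]; exact h1 x⟩
    · obtain ⟨j, rfl⟩ : ∃ l, j = l + 1 := ⟨j - 1, by omega⟩
      -- Subtracting `1` gives compact support without changing derivatives of positive order, which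
      -- are therefore bounded.
      have hV : ContDiff ℝ ∞ (fun x => NormedSpace.exp (B x) - 1) := hW.sub contDiff_const
      have hVc : HasCompactSupport (fun x => NormedSpace.exp (B x) - 1) :=
        hc.comp_left (g := fun a => NormedSpace.exp a - 1) (by simp)
      obtain ⟨C, hC⟩ := (hVc.iteratedFDeriv (𝕜 := ℝ) (j + 1)).exists_bound_of_continuous
        (hV.continuous_iteratedFDeriv (by exact_mod_cast le_top))
      refine ⟨C, fun x => ?_⟩
      have e : (fun x => NormedSpace.exp (B x)) = fun x => (NormedSpace.exp (B x) - 1) + 1 := by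
        ext; simp
      have := hC x
      rw [e]
      rw [fun_iteratedFDeriv_add (hV.of_le (by exact_mod_cast le_top)) contDiff_const,
        iteratedFDeriv_succ_const]
      simpa using this
  obtain ⟨C, hC0, hC⟩ := main B hB hc hs
  obtain ⟨C', hC0', hC'⟩ := main (fun x => -B x) hB.neg
    (hc.comp_left (g := fun a => -a) (by simp)) (fun x => by simp [hs x])
  refine ⟨C + C', by positivity, fun n x => ?_⟩
  obtain ⟨m, rfl | rfl⟩ := n.eq_nat_or_neg
  · have := hC m x
    simp only [natCast_zsmul, Int.cast_natCast, Nat.abs_cast]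
    refine this.trans ?_
    gcongr
    linarith
  · have := hC' m x
    simp only [smul_neg] at this
    simp only [neg_smul, natCast_zsmul, Int.cast_neg, Int.cast_natCast, abs_neg, Nat.abs_cast]
    refine this.trans ?_
    gcongr
    linarith

/-! ### Rapidly convergent Fourier expansions -/

open FourierTransform in
theorem SchwartzMap.summable_norm_fourier_mul_pow (f : SchwartzMap ℝ ℂ) (k : ℕ) :
    Summable fun n : ℤ => ‖(𝓕 f) (n : ℝ)‖ * (|(n : ℝ)| + 1) ^ k := by
  -- Decay of order `k + 2` leaves a summable factor `|n|⁻²` after the weight of degree `k`.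
  have h := SchwartzMap.one_add_le_sup_seminorm_apply (𝕜 := ℝ) (m := (k + 2, 0))
    (k := k + 2) (n := 0) le_rfl le_rfl (𝓕 f)
  simp only [norm_iteratedFDeriv_zero, Real.norm_eq_abs] at h
  set K : ℝ := 2 ^ (k + 2) *
    ((Finset.Iic (k + 2, 0)).sup fun m => SchwartzMap.seminorm ℝ m.1 m.2) (𝓕 f)
  refine Summable.of_norm_bounded_eventually
    ((Real.summable_abs_int_rpow (b := 2) one_lt_two).mul_left K) ?_
  have hfin : {n : ℤ | ¬ n ≠ 0}.Finite := by simp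
  filter_upwards [hfin] with n hn
  have hn0 : 0 < |(n : ℝ)| := abs_pos.2 (by exact_mod_cast hn)
  rw [Real.norm_of_nonneg (by positivity), Real.rpow_neg hn0.le, ← div_eq_mul_inv,
    le_div_iff₀ (by positivity)]
  refine le_trans ?_ (h n)
  have h2 : |(n : ℝ)| ^ (2 : ℝ) ≤ (1 + |(n : ℝ)|) ^ 2 := by
    rw [Real.rpow_two]; gcongr; linarith
  calc ‖(𝓕 f) (n : ℝ)‖ * (|(n : ℝ)| + 1) ^ k * |(n : ℝ)| ^ (2 : ℝ)
      ≤ ‖(𝓕 f) (n : ℝ)‖ * (|(n : ℝ)| + 1) ^ k * (1 + |(n : ℝ)|) ^ 2 := by gcongr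
    _ = _ := by rw [add_comm |(n : ℝ)| 1]; ring

-- Poisson summation: for `|y| ≤ 1/4` every translate `y + n` with `n ≠ 0` lies outside the support,
-- so the periodization reduces to `f y`.
open FourierTransform in
theorem SchwartzMap.hasSum_fourier_of_support_subset (f : SchwartzMap ℝ ℂ)
    (hf : ∀ y : ℝ, 1 / 2 ≤ |y| → f y = 0) {y : ℝ} (hy : |y| ≤ 1 / 4) :
    HasSum (fun n : ℤ => (𝓕 f) (n : ℝ) * Complex.exp (n * (2 * Real.pi * Complex.I * y))) (f y) := by
  have hP := f.tsum_eq_tsum_fourier y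
  have e : ∀ n : ℤ, (fourier n (y : UnitAddCircle) : ℂ) =
      Complex.exp (n * (2 * Real.pi * Complex.I * y)) := by
    intro n
    rw [fourier_coe_apply]
    congr 1
    push_cast
    ring
  rw [tsum_eq_single 0] at hP
  · rw [Int.cast_zero, add_zero] at hP
    rw [hP]
    simp_rw [e]
    refine (Summable.of_norm ?_).hasSum
    refine (f.summable_norm_fourier_mul_pow 0).congr fun n => ?_
    rw [norm_mul, pow_zero, Complex.norm_exp]
    simp
  · intro n hn
    have h1 : (1 : ℝ) ≤ |(n : ℝ)| := by exact_mod_cast Int.one_le_abs hn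
    refine hf _ ?_
    have := abs_sub_abs_le_abs_sub (n : ℝ) (-y)
    rw [abs_neg, sub_neg_eq_add, add_comm (n : ℝ)] at this
    linarith

theorem exists_smooth_cutoff : ∃ χ : ℝ → ℝ, ContDiff ℝ ∞ χ ∧ HasCompactSupport χ ∧
    (∀ y, |y| ≤ 1 / 4 → χ y = 1) ∧ ∀ y, 1 / 2 ≤ |y| → χ y = 0 := by
  obtain ⟨χ, h1, h2⟩ : ∃ χ : ContDiffBump (0 : ℝ), χ.rIn = 1 / 4 ∧ χ.rOut = 1 / 2 :=
    ⟨⟨1 / 4, 1 / 2, by norm_num, by norm_num⟩, rfl, rfl⟩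
  refine ⟨χ, χ.contDiff, χ.hasCompactSupport, fun y hy => χ.one_of_mem_closedBall ?_,
    fun y hy => χ.zero_of_le_dist ?_⟩
  · rw [h1, mem_closedBall_zero_iff]; exact hy
  · rw [h2, dist_zero_right]; exact hy

open FourierTransform in
theorem SchwartzMap.exists_fourier_expansion (f : SchwartzMap ℝ ℂ)
    (hf : ∀ y : ℝ, 1 / 2 ≤ |y| → f y = 0) :
    ∃ c : ℤ → ℂ, (∀ k : ℕ, Summable fun n : ℤ => ‖c n‖ * (|(n : ℝ)| + 1) ^ k) ∧
      ∀ y : ℝ, |y| ≤ 1 / 4 →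
        HasSum (fun n : ℤ => c n * Complex.exp (n * (2 * Real.pi * Complex.I * y))) (f y) := by
  have h1 := f.summable_norm_fourier_mul_pow
  have h2 := fun y (hy : |y| ≤ 1 / 4) => f.hasSum_fourier_of_support_subset hf hy
  generalize 𝓕 f = F at h1 h2
  exact ⟨fun n => F n, h1, h2⟩

/-- Scaling by `4 * R` brings `[-R, R]` to `[-1/4, 1/4]`, where the cutoff equals one; the cut-off
function is Schwartz. -/
theorem exists_fourier_expansion {φ : ℝ → ℝ} (hφ : ContDiff ℝ ∞ φ) {R : ℝ} (hR : 0 < R) :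
    ∃ c : ℤ → ℂ, (∀ k : ℕ, Summable fun n : ℤ => ‖c n‖ * (|(n : ℝ)| + 1) ^ k) ∧
      ∀ x : ℝ, |x| ≤ R →
        HasSum (fun n : ℤ => c n * Complex.exp (n * (2 * Real.pi * Complex.I / (4 * R) * x)))
          (φ x : ℂ) := by
  obtain ⟨χ, hχ, hχc, h1, h2⟩ := exists_smooth_cutoff
  have hsm : ContDiff ℝ ∞ (fun y : ℝ => χ y * φ (4 * R * y)) :=
    hχ.mul (hφ.comp (contDiff_const.mul contDiff_id))
  have hcs : HasCompactSupport (fun y : ℝ => χ y * φ (4 * R * y)) :=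
    hχc.mul_right (f' := fun y => φ (4 * R * y))
  have hcs' : HasCompactSupport (fun y : ℝ => ((χ y * φ (4 * R * y) : ℝ) : ℂ)) :=
    hcs.comp_left (g := fun a : ℝ => (a : ℂ)) Complex.ofReal_zero
  obtain ⟨f, hf⟩ : ∃ f : SchwartzMap ℝ ℂ, ∀ y, f y = ((χ y * φ (4 * R * y) : ℝ) : ℂ) :=
    ⟨hcs'.toSchwartzMap (Complex.ofRealCLM.contDiff.comp hsm), fun _ => rfl⟩
  obtain ⟨c, hc, hsum⟩ := f.exists_fourier_expansion fun y hy => by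
    rw [hf, h2 y hy, zero_mul, Complex.ofReal_zero]
  refine ⟨c, hc, fun x hx => ?_⟩
  have hR4 : (0 : ℝ) < 4 * R := by linarith
  have hy : |x / (4 * R)| ≤ 1 / 4 := by
    rw [abs_div, abs_of_pos hR4, div_le_iff₀ hR4]
    linarith
  have h := hsum _ hy
  have h0 : f (x / (4 * R)) = (φ x : ℂ) := by
    rw [hf, h1 _ hy, one_mul, mul_div_cancel₀ _ hR4.ne']
  rw [h0] at h
  refine h.congr_fun fun n => ?_
  congr 3
  push_cast
  ring

/-! ### Smoothness and continuity of the spectral map -/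

theorem Matrix.IsHermitian.exists_real_diagonalization {p : ℕ} {M : Mat p} (hM : M.IsHermitian) :
    ∃ (U : Mat p) (l : Fin p → ℝ), U * Uᵀ = 1 ∧ Uᵀ * U = 1 ∧ (∀ i, l i ∈ spectrum ℝ M) ∧
      M = U * Matrix.diagonal l * Uᵀ ∧
      ∀ φ : ℝ → ℝ, spectralMap φ M = U * Matrix.diagonal (φ ∘ l) * Uᵀ := by
  have hU := hM.eigenvectorUnitary.2
  have h : ∀ φ : ℝ → ℝ, spectralMap φ M = (hM.eigenvectorUnitary : Mat p) *
      Matrix.diagonal (φ ∘ hM.eigenvalues) * (hM.eigenvectorUnitary : Mat p)ᵀ := by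
    intro φ
    rw [spectralMap, hM.cfc_eq, Matrix.IsHermitian.cfc, Unitary.conjStarAlgAut_apply]
    rfl
  refine ⟨hM.eigenvectorUnitary, hM.eigenvalues, Unitary.mul_star_self_of_mem hU,
    Unitary.star_mul_self_of_mem hU, hM.eigenvalues_mem_spectrum_real, ?_, h⟩
  have h1 := hM.spectral_theorem
  rw [Unitary.conjStarAlgAut_apply] at h1
  exact h1

theorem spectralMap_isSymm {p : ℕ} {M : Mat p} (hM : M.IsSymm) (φ : ℝ → ℝ) :
    (spectralMap φ M).IsSymm := by
  obtain ⟨U, l, -, -, -, -, h⟩ :=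
    Matrix.IsHermitian.exists_real_diagonalization (Matrix.isHermitian_iff_isSymm.2 hM)
  rw [Matrix.IsSymm, h φ]
  simp [Matrix.mul_assoc]

theorem exp_zsmul_conj_diagonal {p : ℕ} {U : Mat p} (h1 : U * Uᵀ = 1) (l : Fin p → ℝ) (z : ℂ)
    (n : ℤ) :
    NormedSpace.exp (n • z • (U * Matrix.diagonal l * Uᵀ).map Complex.ofReal) =
      U.map Complex.ofReal * Matrix.diagonal (fun i => Complex.exp (n * (z * l i))) *
        (U.map Complex.ofReal)ᵀ := by
  have hV : U.map Complex.ofReal * (U.map Complex.ofReal)ᵀ = 1 := by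
    have := congrArg (fun M : Mat p => M.map Complex.ofRealHom) h1
    simp only [Matrix.map_mul, Matrix.transpose_map,
      Matrix.map_one _ (map_zero _) (map_one _)] at this
    exact this
  have hinv := Matrix.inv_eq_right_inv hV
  have hunit : IsUnit (U.map Complex.ofReal) :=
    (Matrix.isUnit_iff_isUnit_det _).2 (Matrix.isUnit_det_of_right_inverse hV)
  have e : n • z • (U * Matrix.diagonal l * Uᵀ).map Complex.ofReal =
      U.map Complex.ofReal * Matrix.diagonal (fun i => (n * (z * l i) : ℂ)) *
        (U.map Complex.ofReal)⁻¹ := by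
    have h2 : (U * Matrix.diagonal l * Uᵀ).map Complex.ofReal = U.map Complex.ofReal *
        Matrix.diagonal (fun i => (l i : ℂ)) * (U.map Complex.ofReal)ᵀ := by
      have : ∀ A B : Mat p, (A * B).map Complex.ofReal =
          A.map Complex.ofReal * B.map Complex.ofReal :=
        fun A B => Matrix.map_mul (f := Complex.ofRealHom)
      rw [this, this, Matrix.diagonal_map Complex.ofReal_zero, Matrix.transpose_map]
    have h3 : Matrix.diagonal (fun i => (n * (z * l i) : ℂ)) =
        (n : ℂ) • z • Matrix.diagonal (fun i => (l i : ℂ)) := by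
      rw [← Matrix.diagonal_smul, ← Matrix.diagonal_smul]; rfl
    rw [hinv, h2, h3, ← Int.cast_smul_eq_zsmul ℂ]
    simp only [Matrix.mul_smul, Matrix.smul_mul]
  rw [e, Matrix.exp_conj _ _ hunit, hinv, Matrix.exp_diagonal]
  congr 3
  funext i
  rw [Pi.coe_exp, Complex.exp_eq_exp_ℂ]

open scoped Matrix.Norms.L2Operator in
theorem abs_le_norm_of_mem_spectrum {p : ℕ} {M : Mat p} {x : ℝ} (hx : x ∈ spectrum ℝ M) :
    |x| ≤ ‖M‖ := by
  rcases subsingleton_or_nontrivial (Mat p) with h | h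
  · rw [spectrum.of_subsingleton] at hx
    exact absurd hx (Set.notMem_empty _)
  · have := spectrum.norm_le_norm_mul_of_mem hx
    rwa [CStarRing.norm_one, mul_one] at this

-- In an eigenbasis each entry is a finite combination of the scalar series at the eigenvalues, all
-- bounded by `‖M‖ ≤ R`.
open scoped Matrix.Norms.L2Operator in
theorem hasSum_spectralMap {p : ℕ} {M : Mat p} (hM : M.IsSymm) {φ : ℝ → ℝ} {R : ℝ} (hR : ‖M‖ ≤ R)
    {z : ℂ} {c : ℤ → ℂ}
    (hc : ∀ x : ℝ, |x| ≤ R → HasSum (fun n : ℤ => c n * Complex.exp (n * (z * x))) (φ x : ℂ))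
    (a b : Fin p) :
    HasSum (fun n : ℤ => c n * NormedSpace.exp (n • z • M.map Complex.ofReal) a b)
      (spectralMap φ M a b : ℂ) := by
  obtain ⟨U, l, hU, -, hl, hMU, h⟩ :=
    Matrix.IsHermitian.exists_real_diagonalization (Matrix.isHermitian_iff_isSymm.2 hM)
  have e1 : (spectralMap φ M a b : ℂ) = ∑ i, (U a i : ℂ) * (φ (l i) : ℂ) * (U b i : ℂ) := by
    rw [h φ, Matrix.mul_apply]
    simp [Matrix.mul_diagonal]
  have e2 : ∀ n : ℤ, c n * NormedSpace.exp (n • z • M.map Complex.ofReal) a b =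
      ∑ i, (U a i : ℂ) * (c n * Complex.exp (n * (z * l i))) * (U b i : ℂ) := by
    intro n
    rw [hMU, exp_zsmul_conj_diagonal hU, Matrix.mul_apply, Finset.mul_sum]
    refine Finset.sum_congr rfl fun i _ => ?_
    rw [Matrix.mul_diagonal, Matrix.transpose_apply, Matrix.map_apply, Matrix.map_apply]
    ring
  rw [e1]
  simp_rw [e2]
  exact hasSum_sum fun i _ =>
    ((hc (l i) ((abs_le_norm_of_mem_spectrum (hl i)).trans hR)).mul_left _).mul_right _

open scoped Matrix.Norms.L2Operator in
theorem contDiff_complexify {E : Type*} [NormedAddCommGroup E] [NormedSpace ℝ E] {p : ℕ}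
    {M : E → Mat p} (h : ∀ a b, ContDiff ℝ ∞ fun x => M x a b) (z : ℂ) :
    ContDiff ℝ ∞ (fun x => z • (M x).map Complex.ofReal) := by
  have : (fun x => z • (M x).map Complex.ofReal) =
      fun x => ∑ a, ∑ b, M x a b • (Matrix.single a b z) := by
    funext x
    rw [Matrix.matrix_eq_sum_single (z • (M x).map Complex.ofReal)]
    refine Finset.sum_congr rfl fun a _ => Finset.sum_congr rfl fun b _ => ?_
    ext i j
    simp [Matrix.single_apply, mul_comm]
  rw [this]
  exact ContDiff.sum fun a _ => ContDiff.sum fun b _ => (h a b).smul contDiff_const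

-- Compact support gives one radius `R` for all spectra and uniform derivative bounds, so every
-- termwise derivative of the Fourier series is dominated by a summable sequence.
open scoped Matrix.Norms.L2Operator in
theorem contDiff_spectralMap_of_hasCompactSupport {E : Type*} [NormedAddCommGroup E]
    [NormedSpace ℝ E] {p : ℕ} {M : E → Mat p} (h : ∀ a b, ContDiff ℝ ∞ fun x => M x a b)
    (hs : ∀ x, (M x).IsSymm) (hc : HasCompactSupport M) {φ : ℝ → ℝ} (hφ : ContDiff ℝ ∞ φ)
    (a b : Fin p) : ContDiff ℝ ∞ fun x => spectralMap φ (M x) a b := by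
  have hcont : Continuous M := continuous_matrix fun i j => (h i j).continuous
  obtain ⟨R, hR⟩ := hc.exists_bound_of_continuous hcont
  obtain ⟨c, hcs, hsum⟩ := exists_fourier_expansion hφ (R := max R 1) (by positivity)
  set z : ℂ := 2 * Real.pi * Complex.I / (4 * (max R 1 : ℝ)) with hz
  -- `z` is imaginary, so `z M` is skew-adjoint for real symmetric `M` and the exponentials are
  -- unitary.
  have hzstar : star z = -z := by
    have hz' : z = ((2 * Real.pi / (4 * max R 1) : ℝ) : ℂ) * Complex.I := by
      rw [hz]; push_cast; ring
    rw [hz', star_mul']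
    simp
  have hB : ContDiff ℝ ∞ (fun x => z • (M x).map Complex.ofReal) := contDiff_complexify h z
  have hBc : HasCompactSupport (fun x => z • (M x).map Complex.ofReal) :=
    hc.comp_left (g := fun A : Mat p => z • A.map Complex.ofReal) (by ext; simp)
  have hBs : ∀ x, star (z • (M x).map Complex.ofReal) = -(z • (M x).map Complex.ofReal) := by
    intro x
    rw [star_smul, hzstar, neg_smul]
    congr 2
    ext i j
    simp [Matrix.star_apply, (hs x).apply]
  have hbd := fun k => exists_bound_iteratedFDeriv_exp_zsmul hB hBc hBs k
  choose C hC0 hC using hbd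
  have hentry : ContDiff ℝ ∞ (fun A : Matrix (Fin p) (Fin p) ℂ => A a b) := by
    let L : Matrix (Fin p) (Fin p) ℂ →ₗ[ℝ] ℂ :=
      { toFun := fun A => A a b, map_add' := fun _ _ => rfl, map_smul' := fun _ _ => rfl }
    exact L.toContinuousLinearMap.contDiff
  have hS : ContDiff ℝ ∞ fun x =>
      ∑' n : ℤ, c n • NormedSpace.exp (n • z • (M x).map Complex.ofReal) := by
    have hexp : ∀ n : ℤ, ContDiff ℝ ∞ fun x =>
        NormedSpace.exp (n • z • (M x).map Complex.ofReal) := fun n =>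
      contDiff_normedSpace_exp.comp (hB.const_smul n)
    refine contDiff_tsum (v := fun k n => C k * (‖c n‖ * (|(n : ℝ)| + 1) ^ k))
      (fun n => (hexp n).const_smul _) (fun k _ => (hcs k).mul_left _) (fun k n x _ => ?_)
    have e : iteratedFDeriv ℝ k (fun x =>
        c n • NormedSpace.exp (n • z • (M x).map Complex.ofReal)) x = _ :=
      iteratedFDeriv_const_smul_apply (a := c n) (x := x)
      ((hexp n).contDiffAt.of_le (m := (k : ℕ∞ω)) (by exact_mod_cast le_top))
    rw [e, norm_smul]
    calc _ ≤ ‖c n‖ * (C k * (|(n : ℝ)| + 1) ^ k) := by gcongr; exact hC k n x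
      _ = _ := by ring
  have hR' : ∀ x, ‖M x‖ ≤ max R 1 := fun x => (hR x).trans (le_max_left _ _)
  have hsum' : ∀ x, Summable fun n : ℤ =>
      c n • NormedSpace.exp (n • z • (M x).map Complex.ofReal) := by
    intro x
    refine Summable.of_norm_bounded ((hcs 0).mul_left (C 0)) fun n => ?_
    have := hC 0 n x
    rw [norm_iteratedFDeriv_zero] at this
    rw [norm_smul]
    calc _ ≤ ‖c n‖ * (C 0 * (|(n : ℝ)| + 1) ^ 0) := by gcongr
      _ = _ := by ring
  have e : (fun x => spectralMap φ (M x) a b) = fun x =>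
      Complex.reCLM ((∑' n : ℤ, c n • NormedSpace.exp (n • z • (M x).map Complex.ofReal)) a b) := by
    funext x
    have h1 := hasSum_spectralMap (hs x) (hR' x) (z := z) hsum a b
    have h2 : HasSum (fun n : ℤ => c n * NormedSpace.exp (n • z • (M x).map Complex.ofReal) a b)
        ((∑' n : ℤ, c n • NormedSpace.exp (n • z • (M x).map Complex.ofReal)) a b) :=
      Pi.hasSum.1 (Pi.hasSum.1 (hsum' x).hasSum a) b
    rw [← h1.unique h2]
    simp
  rw [e]
  exact Complex.reCLM.contDiff.comp (hentry.comp hS)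

/-- Smoothness is local: multiplying by a bump function equal to one near the point reduces to
compact support. -/
theorem contDiff_spectralMap {n p : ℕ} {M : Vec n → Mat p}
    (h : ∀ a b, ContDiff ℝ ∞ fun x => M x a b) (hs : ∀ x, (M x).IsSymm) {φ : ℝ → ℝ}
    (hφ : ContDiff ℝ ∞ φ) (a b : Fin p) : ContDiff ℝ ∞ fun x => spectralMap φ (M x) a b := by
  refine contDiff_iff_contDiffAt.2 fun x₀ => ?_
  obtain ⟨χ⟩ : Nonempty (ContDiffBump x₀) := inferInstance
  have h' := contDiff_spectralMap_of_hasCompactSupport (M := fun x => χ x • M x)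
    (fun a b => χ.contDiff.mul (h a b)) (fun x => (hs x).smul _)
    (χ.hasCompactSupport.smul_right) hφ a b
  refine h'.contDiffAt.congr_of_eventuallyEq ?_
  filter_upwards [χ.eventuallyEq_one] with x hx
  rw [hx]
  simp

-- Serves the top-level function `αr`, which is only continuous. Locally all spectra lie in one
-- compact ball.
open scoped Matrix.Norms.L2Operator in
theorem continuous_spectralMap {n p : ℕ} {M : Vec n → Mat p} (hM : Continuous M)
    (hs : ∀ x, (M x).IsSymm) {φ : ℝ → ℝ} (hφ : Continuous φ) :
    Continuous fun x => spectralMap φ (M x) := by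
  refine Continuous.cfc φ hM (s := fun x => Metric.closedBall 0 (‖M x‖ + 1))
    (fun x => isCompact_closedBall _ _) (fun x₀ => ?_) (fun x => hφ.continuousOn)
    (fun x => Matrix.isHermitian_iff_isSymm.2 (hs x))
  have : ∀ᶠ x in nhds x₀, ‖M x‖ < ‖M x₀‖ + 1 :=
    hM.norm.continuousAt.eventually_lt continuousAt_const (lt_add_one _)
  filter_upwards [this] with x hx y hy
  rw [mem_closedBall_zero_iff, Real.norm_eq_abs]
  exact (abs_le_norm_of_mem_spectrum hy).trans hx.le

/-! ### Lie derivatives and regularity of the barrier sequence -/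

section
variable {n m p : ℕ}

theorem matLie_apply (v : Vec n → Vec n) (M : Vec n → Mat p) (x : Vec n) (a b : Fin p) :
    matLie v M x a b = fderiv ℝ (fun y => M y a b) x (v x) := rfl

theorem matLie_isSymm {v : Vec n → Vec n} {M : Vec n → Mat p} (hM : ∀ x, (M x).IsSymm)
    (x : Vec n) : (matLie v M x).IsSymm := by
  refine Matrix.IsSymm.ext fun a b => ?_
  simp only [matLie_apply]
  congr 2
  funext y
  exact (hM y).apply a b

theorem contDiff_matLie {v : Vec n → Vec n} {M : Vec n → Mat p} (hv : ContDiff ℝ ∞ v)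
    (hM : ∀ a b, ContDiff ℝ ∞ fun x => M x a b) (a b : Fin p) :
    ContDiff ℝ ∞ fun x => matLie v M x a b :=
  ((hM a b).fderiv_right (m := ∞) (by simp)).clm_apply hv

theorem contDiff_ctrlCol {g : Vec n → Matrix (Fin n) (Fin m) ℝ}
    (hg : ∀ i j, ContDiff ℝ ∞ (fun x => g x i j)) (j : Fin m) : ContDiff ℝ ∞ (ctrlCol g j) :=
  contDiff_euclidean.2 fun i => hg i j

theorem barrierSeq_succ (f : Vec n → Vec n) (H : Vec n → Mat p) (α : ℕ → ℝ → ℝ) {i : ℕ}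
    (hi : 1 ≤ i) (x : Vec n) : barrierSeq f H α (i + 1) x =
      matLie f (barrierSeq f H α i) x + spectralMap (α i) (barrierSeq f H α i x) := by
  obtain ⟨i, rfl⟩ : ∃ k, i = k + 1 := ⟨i - 1, by omega⟩
  rfl

theorem barrierSeq_isSymm {f : Vec n → Vec n} {H : Vec n → Mat p} (hH : ∀ x, (H x).IsSymm)
    (α : ℕ → ℝ → ℝ) (i : ℕ) (x : Vec n) : (barrierSeq f H α i x).IsSymm := by
  induction i generalizing x with
  | zero => exact Matrix.isSymm_zero
  | succ i ih =>
    rcases Nat.eq_zero_or_pos i with rfl | hi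
    · exact hH x
    · rw [barrierSeq_succ f H α hi]
      exact (matLie_isSymm ih x).add (spectralMap_isSymm (ih x) _)

theorem contDiff_barrierSeq {f : Vec n → Vec n} {H : Vec n → Mat p} {α : ℕ → ℝ → ℝ} {r : ℕ}
    (hf : ContDiff ℝ ∞ f) (hH : ∀ a b, ContDiff ℝ ∞ (fun x => H x a b))
    (hHs : ∀ x, (H x).IsSymm) (hα : ∀ i, 1 ≤ i → i < r → ContDiff ℝ ∞ (α i)) (i : ℕ) (hir : i ≤ r)
    (a b : Fin p) : ContDiff ℝ ∞ fun x => barrierSeq f H α i x a b := by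
  induction i generalizing a b with
  | zero => exact contDiff_const
  | succ i ih =>
    rcases Nat.eq_zero_or_pos i with rfl | hi
    · exact hH a b
    · have ih' := ih (by omega)
      simp only [barrierSeq_succ f H α hi]
      exact (contDiff_matLie hf ih' a b).add
        (contDiff_spectralMap ih' (barrierSeq_isSymm hHs α i) (hα i hi (by omega)) a b)

theorem closedLoop_eq (f : Vec n → Vec n) (g : Vec n → Matrix (Fin n) (Fin m) ℝ)
    (k : Vec n → Vec m) (x : Vec n) :
    closedLoop f g k x = f x + ∑ j, k x j • ctrlCol g j x := by
  unfold closedLoop ctrlCol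
  congr 1
  ext i
  simp [Matrix.mulVec, dotProduct, mul_comm]

theorem matLie_closedLoop (f : Vec n → Vec n) (g : Vec n → Matrix (Fin n) (Fin m) ℝ)
    (k : Vec n → Vec m) (M : Vec n → Mat p) (x : Vec n) :
    matLie (closedLoop f g k) M x = matLie f M x + ∑ j, k x j • matLie (ctrlCol g j) M x := by
  ext a b
  simp [matLie_apply, closedLoop_eq, Matrix.sum_apply]

theorem continuous_barrierDot {f : Vec n → Vec n} {g : Vec n → Matrix (Fin n) (Fin m) ℝ}
    {H : Vec n → Mat p} {α : ℕ → ℝ → ℝ} {r : ℕ} (hf : ContDiff ℝ ∞ f)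
    (hg : ∀ i j, ContDiff ℝ ∞ (fun x => g x i j))
    (hΨ : ∀ a b, ContDiff ℝ ∞ fun x => barrierSeq f H α r x a b) :
    Continuous fun q : Vec n × Vec m => barrierDot f g H α r q.1 q.2 := by
  have h : ∀ v : Vec n → Vec n, ContDiff ℝ ∞ v →
      Continuous (matLie v (barrierSeq f H α r)) := fun v hv =>
    continuous_matrix fun a b => (contDiff_matLie hv hΨ a b).continuous
  have hj := fun j => h _ (contDiff_ctrlCol hg j)
  have h0 := h f hf
  unfold barrierDot
  fun_prop

theorem hasDerivWithinAt_comp_apply {M : Vec n → Mat p} {F : Vec n → Vec n} {x : ℝ → Vec n}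
    {s : Set ℝ} {t : ℝ} (hM : ∀ a b, ContDiff ℝ ∞ fun y => M y a b)
    (hx : HasDerivWithinAt x (F (x t)) s t) (a b : Fin p) :
    HasDerivWithinAt (fun t => M (x t) a b) (matLie F M (x t) a b) s t := by
  have h := ((hM a b).differentiable (by simp) (x t)).hasFDerivAt
  exact h.comp_hasDerivWithinAt t hx

end

/-! ### Quadratic forms and the matrix comparison principle -/

/-- The value of the quadratic form of `M` at `v`. -/
def quadVal {p : ℕ} (M : Mat p) (v : Vec p) : ℝ := v.ofLp ⬝ᵥ M *ᵥ v.ofLp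

theorem quadVal_eq_sum {p : ℕ} (M : Mat p) (v : Vec p) :
    quadVal M v = ∑ a, ∑ b, M a b * (v a * v b) := by
  simp only [quadVal, dotProduct, Matrix.mulVec, Finset.mul_sum]
  exact Finset.sum_congr rfl fun a _ => Finset.sum_congr rfl fun b _ => by ring

theorem quadVal_add {p : ℕ} (M N : Mat p) (v : Vec p) :
    quadVal (M + N) v = quadVal M v + quadVal N v := by
  simp [quadVal, Matrix.add_mulVec, dotProduct_add]

theorem quadVal_smul {p : ℕ} (c : ℝ) (M : Mat p) (v : Vec p) :
    quadVal (c • M) v = c * quadVal M v := by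
  simp [quadVal, Matrix.smul_mulVec, dotProduct_smul]

theorem quadVal_smul_right {p : ℕ} (M : Mat p) (c : ℝ) (v : Vec p) :
    quadVal M (c • v) = c ^ 2 * quadVal M v := by
  simp [quadVal, Matrix.mulVec_smul, dotProduct_smul, smul_dotProduct]
  ring

theorem quadVal_one {p : ℕ} (v : Vec p) : quadVal (1 : Mat p) v = ‖v‖ ^ 2 := by
  rw [EuclideanSpace.real_norm_sq_eq]
  simp [quadVal, dotProduct, pow_two]

theorem continuous_quadVal {p : ℕ} : Continuous fun q : Mat p × Vec p => quadVal q.1 q.2 := by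
  unfold quadVal
  fun_prop

theorem posSemidef_iff_quadVal {p : ℕ} {M : Mat p} (hM : M.IsSymm) :
    M.PosSemidef ↔ ∀ v, 0 ≤ quadVal M v := by
  rw [Matrix.posSemidef_iff_dotProduct_mulVec]
  constructor
  · intro h v
    have := h.2 v.ofLp
    rwa [star_trivial] at this
  · exact fun h => ⟨Matrix.isHermitian_iff_isSymm.2 hM, fun x => by
      rw [star_trivial]; exact h (WithLp.toLp 2 x)⟩

theorem quadVal_eq_normalize {p : ℕ} (M : Mat p) {v : Vec p} (hv : v ≠ 0) :
    quadVal M v = ‖v‖ ^ 2 * quadVal M (‖v‖⁻¹ • v) := by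
  rw [quadVal_smul_right, inv_pow, mul_inv_cancel_left₀]
  exact pow_ne_zero _ (norm_ne_zero_iff.2 hv)

theorem normalize_mem_sphere {p : ℕ} {v : Vec p} (hv : v ≠ 0) :
    ‖v‖⁻¹ • v ∈ Metric.sphere (0 : Vec p) 1 := by
  rw [mem_sphere_zero_iff_norm, norm_smul, norm_inv, norm_norm,
    inv_mul_cancel₀ (norm_ne_zero_iff.2 hv)]

theorem posDef_iff_quadVal {p : ℕ} {M : Mat p} (hM : M.IsSymm) :
    M.PosDef ↔ ∀ v ∈ Metric.sphere (0 : Vec p) 1, 0 < quadVal M v := by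
  rw [Matrix.posDef_iff_dotProduct_mulVec]
  constructor
  · intro h v hv
    have hv0 : v ≠ 0 := by
      rintro rfl
      simp at hv
    have := h.2 (x := v.ofLp) (by simpa using hv0)
    rwa [star_trivial] at this
  · refine fun h => ⟨Matrix.isHermitian_iff_isSymm.2 hM, fun x hx => ?_⟩
    have hv0 : WithLp.toLp 2 x ≠ 0 := by simpa using hx
    have h1 := h _ (normalize_mem_sphere hv0)
    have h2 : 0 < quadVal M (WithLp.toLp 2 x) := by
      rw [quadVal_eq_normalize M hv0]
      have := norm_pos_iff.2 hv0
      positivity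
    simpa [quadVal] using h2

theorem spectralMap_mulVec_of_eigenvector {p : ℕ} {M : Mat p} (hM : M.IsSymm) (φ : ℝ → ℝ)
    {l : ℝ} {v : Fin p → ℝ} (hv : M *ᵥ v = l • v) : spectralMap φ M *ᵥ v = φ l • v := by
  obtain ⟨U, d, h1, h2, -, hMU, h⟩ :=
    Matrix.IsHermitian.exists_real_diagonalization (Matrix.isHermitian_iff_isSymm.2 hM)
  have hy : Matrix.diagonal d *ᵥ (Uᵀ *ᵥ v) = l • (Uᵀ *ᵥ v) := by
    have := congrArg (fun w => Uᵀ *ᵥ w) hv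
    rw [hMU] at this
    simp only [Matrix.mulVec_mulVec, Matrix.mulVec_smul] at this
    rw [← this, Matrix.mulVec_mulVec, ← Matrix.mul_assoc, ← Matrix.mul_assoc, h2, Matrix.one_mul]
  have hy' : Matrix.diagonal (φ ∘ d) *ᵥ (Uᵀ *ᵥ v) = φ l • (Uᵀ *ᵥ v) := by
    funext i
    have hi := congrFun hy i
    simp only [Matrix.mulVec_diagonal, Pi.smul_apply, smul_eq_mul, Function.comp] at hi ⊢
    -- A nonzero coordinate of the eigenvector in the eigenbasis forces `d i = l`.
    by_cases h0 : (Uᵀ *ᵥ v) i = 0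
    · simp [h0]
    · rw [mul_right_cancel₀ h0 hi]
  rw [h φ, ← Matrix.mulVec_mulVec, ← Matrix.mulVec_mulVec, hy', Matrix.mulVec_smul,
    Matrix.mulVec_mulVec, h1, Matrix.one_mulVec]

/-- With `l` the minimum, `M - l` is positive semidefinite and its form vanishes at `v`; hence it
kills `v`, which is an eigenvector. -/
theorem quadVal_spectralMap_of_isMinOn {p : ℕ} {M : Mat p} (hM : M.IsSymm) (φ : ℝ → ℝ) {v : Vec p}
    (hv : v ∈ Metric.sphere (0 : Vec p) 1)
    (hmin : ∀ w ∈ Metric.sphere (0 : Vec p) 1, quadVal M v ≤ quadVal M w) :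
    quadVal (spectralMap φ M) v = φ (quadVal M v) := by
  have hv1 : ‖v‖ = 1 := mem_sphere_zero_iff_norm.1 hv
  set l := quadVal M v with hl
  have hN : ∀ w, quadVal (M + (-l) • 1) w = quadVal M w - l * ‖w‖ ^ 2 := by
    intro w
    rw [quadVal_add, quadVal_smul, quadVal_one]
    ring
  have hNs : (M + (-l) • (1 : Mat p)).IsSymm := hM.add (Matrix.isSymm_one.smul _)
  have hpsd : (M + (-l) • (1 : Mat p)).PosSemidef := by
    refine (posSemidef_iff_quadVal hNs).2 fun w => ?_
    rw [hN]
    by_cases hw : w = 0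
    · subst hw; simp [quadVal]
    · rw [quadVal_eq_normalize M hw]
      nlinarith [hmin _ (normalize_mem_sphere hw), sq_nonneg ‖w‖]
  have h0 : (M + (-l) • (1 : Mat p)) *ᵥ v.ofLp = 0 := by
    rw [← hpsd.dotProduct_mulVec_zero_iff]
    have := hN v
    rw [hv1, ← hl] at this
    simpa [quadVal] using this
  have hev : M *ᵥ v.ofLp = l • v.ofLp := by
    rw [Matrix.add_mulVec, Matrix.smul_mulVec, Matrix.one_mulVec, neg_smul] at h0
    exact add_neg_eq_zero.1 h0
  have h1 := quadVal_one v
  rw [hv1] at h1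
  unfold quadVal at h1 ⊢
  rw [Matrix.one_mulVec] at h1
  rw [spectralMap_mulVec_of_eigenvector hM φ hev, dotProduct_smul, h1]
  simp

/-- Minimizing jointly over time and direction lets `v` stay fixed while `t` varies, so the smallest
eigenvalue is never differentiated. Only the sign of `φ` on negatives matters; no Lipschitz bound
enters. -/
theorem posSemidef_of_differential_inequality {p : ℕ} {P D : ℝ → Mat p} {φ : ℝ → ℝ}
    (hφ : ∀ l < 0, φ l < 0) {T : ℝ} (hsymm : ∀ t, (P t).IsSymm)
    (hderiv : ∀ t ∈ Set.Icc 0 T, ∀ a b,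
      HasDerivWithinAt (fun s => P s a b) (D t a b) (Set.Icc 0 T) t)
    (h0 : (P 0).PosSemidef)
    (hineq : ∀ t ∈ Set.Icc 0 T, (D t + spectralMap φ (P t)).PosSemidef) :
    ∀ t ∈ Set.Icc 0 T, (P t).PosSemidef := by
  intro t₁ ht₁
  rw [posSemidef_iff_quadVal (hsymm t₁)]
  by_contra! hneg
  obtain ⟨v₁, hv₁⟩ := hneg
  have hv₁0 : v₁ ≠ 0 := by
    rintro rfl
    simp [quadVal] at hv₁
  have hw₁ : quadVal (P t₁) (‖v₁‖⁻¹ • v₁) < 0 := by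
    rw [quadVal_smul_right]
    have := norm_pos_iff.2 hv₁0
    exact mul_neg_of_pos_of_neg (by positivity) hv₁
  have hPc : ContinuousOn P (Set.Icc 0 T) :=
    continuousOn_pi.2 fun a => continuousOn_pi.2 fun b t ht => (hderiv t ht a b).continuousWithinAt
  have hqc : ContinuousOn (fun q : ℝ × Vec p => quadVal (P q.1) q.2)
      (Set.Icc 0 T ×ˢ Metric.sphere (0 : Vec p) 1) :=
    continuous_quadVal.comp_continuousOn
      ((hPc.comp continuousOn_fst fun q hq => hq.1).prodMk continuousOn_snd)
  obtain ⟨⟨t, v⟩, ⟨ht, hv⟩, hmin⟩ :=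
    (isCompact_Icc.prod (isCompact_sphere (0 : Vec p) 1)).exists_isMinOn ⟨(t₁, ‖v₁‖⁻¹ • v₁), ht₁, normalize_mem_sphere hv₁0⟩ hqc
  have hmin' : ∀ s ∈ Set.Icc 0 T, ∀ w ∈ Metric.sphere (0 : Vec p) 1,
      quadVal (P t) v ≤ quadVal (P s) w := fun s hs w hw => hmin (Set.mk_mem_prod hs hw)
  have hlt : quadVal (P t) v < 0 :=
    (hmin' t₁ ht₁ _ (normalize_mem_sphere hv₁0)).trans_lt hw₁
  have htpos : 0 < t := by
    refine lt_of_le_of_ne ht.1 fun h => ?_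
    rw [← h] at hlt
    exact absurd ((posSemidef_iff_quadVal (hsymm 0)).1 h0 v) (not_le.2 hlt)
  have hD : 0 < quadVal (D t) v := by
    have h1 := quadVal_spectralMap_of_isMinOn (hsymm t) φ hv (hmin' t ht)
    have h2 := (hineq t ht).dotProduct_mulVec_nonneg v.ofLp
    have h3 : 0 ≤ quadVal (D t + spectralMap φ (P t)) v := by simpa [quadVal] using h2
    rw [quadVal_add, h1] at h3
    linarith [hφ _ hlt]
  have hd : HasDerivWithinAt (fun s => quadVal (P s) v) (quadVal (D t) v) (Set.Icc 0 T) t := by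
    simp only [quadVal_eq_sum]
    exact HasDerivWithinAt.fun_sum fun a _ => HasDerivWithinAt.fun_sum fun b _ =>
      (hderiv t ht a b).mul_const _
  have hloc : IsLocalMinOn (fun s => quadVal (P s) v) (Set.Icc 0 T) t :=
    IsMinOn.localize fun s hs => hmin' s hs v hv
  -- The backward direction is admissible even at `t = T`; minimality along it makes the derivative
  -- nonpositive.
  have hcone : (0 : ℝ) - t ∈ posTangentConeAt (Set.Icc 0 T) t :=
    sub_mem_posTangentConeAt_of_segment_subset
      ((convex_Icc 0 T).segment_subset ht ⟨le_rfl, ht.1.trans ht.2⟩)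
  have := hloc.hasFDerivWithinAt_nonneg hd.hasFDerivWithinAt hcone
  simp at this
  nlinarith

/-! ### Forward invariance of the safe set -/

/-- At a first exit time from `E` the curve is a limit of points of the closed set `C`, hence still
in `C ⊆ E`. The constraint is thus needed only on a neighborhood. -/
theorem mem_of_local_invariance {X : Type*} [TopologicalSpace X] {C E : Set X} (hC : IsClosed C)
    (hE : IsOpen E) (hCE : C ⊆ E) {T : ℝ} {x : ℝ → X} (hx : ContinuousOn x (Set.Icc 0 T))
    (h0 : x 0 ∈ C)
    (hloc : ∀ τ ≤ T, (∀ t ∈ Set.Icc 0 τ, x t ∈ E) → ∀ t ∈ Set.Icc 0 τ, x t ∈ C) :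
    ∀ t ∈ Set.Icc 0 T, x t ∈ C := by
  refine hloc T le_rfl ?_
  by_contra! hne
  obtain ⟨t₁, ht₁, hxt₁⟩ := hne
  have hB : IsCompact (Set.Icc 0 T ∩ x ⁻¹' Eᶜ) :=
    isCompact_Icc.of_isClosed_subset
      (hx.preimage_isClosed_of_isClosed isClosed_Icc hE.isClosed_compl) Set.inter_subset_left
  obtain ⟨b, ⟨hbI, hbE⟩, hbmin⟩ := hB.exists_isLeast ⟨t₁, ht₁, hxt₁⟩
  have hb0 : 0 < b := by
    refine lt_of_le_of_ne hbI.1 fun h => ?_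
    subst h
    exact hbE (hCE h0)
  have hlt : ∀ t ∈ Set.Ico 0 b, x t ∈ C := fun t ht => by
    refine hloc t (ht.2.le.trans hbI.2) (fun s hs => ?_) t ⟨ht.1, le_rfl⟩
    by_contra hsE
    exact absurd (hbmin ⟨⟨hs.1, hs.2.trans (ht.2.le.trans hbI.2)⟩, hsE⟩)
      (not_le.2 (hs.2.trans_lt ht.2))
  have hcl : b ∈ closure (Set.Ico 0 b) := by
    rw [closure_Ico hb0.ne]
    exact ⟨hb0.le, le_rfl⟩
  have hbC : x b ∈ C := by
    have := ((hx b hbI).mono fun t ht => ⟨ht.1, ht.2.le.trans hbI.2⟩ :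
      ContinuousWithinAt x (Set.Ico 0 b) b).mem_closure hcl (t := C) hlt
    rwa [hC.closure_eq] at this
  exact hbE (hCE hbC)

section
variable {n m p : ℕ}

theorem isClosed_safeSet {f : Vec n → Vec n} {H : Vec n → Mat p} {α : ℕ → ℝ → ℝ} {r : ℕ}
    (hs : ∀ i x, (barrierSeq f H α i x).IsSymm) (hc : ∀ i ≤ r, Continuous (barrierSeq f H α i)) :
    IsClosed (safeSet f H α r) := by
  have : safeSet f H α r =
      ⋂ i, ⋂ (_ : 1 ≤ i), ⋂ (_ : i ≤ r), ⋂ v, {x | 0 ≤ quadVal (barrierSeq f H α i x) v} := by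
    ext x
    simp [safeSet, posSemidef_iff_quadVal (hs _ _)]
  rw [this]
  refine isClosed_iInter fun i => isClosed_iInter fun _ => isClosed_iInter fun hi =>
    isClosed_iInter fun v => isClosed_le continuous_const ?_
  exact continuous_quadVal.comp ((hc i hi).prodMk continuous_const)

theorem isForwardInvariantFor_safeSet {f : Vec n → Vec n} {g : Vec n → Matrix (Fin n) (Fin m) ℝ}
    {H : Vec n → Mat p} {α : ℕ → ℝ → ℝ} {r : ℕ} {αr : ℝ → ℝ}
    (hs : ∀ i x, (barrierSeq f H α i x).IsSymm)
    (hΨ : ∀ i ≤ r, ∀ a b, ContDiff ℝ ∞ fun x => barrierSeq f H α i x a b)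
    (hα : ∀ i, 1 ≤ i → i < r → IsExtendedClassK (α i)) (hαr : IsExtendedClassK αr)
    (hr : IsFirstInputLevel f g H α r) {k : Vec n → Vec m} {E : Set (Vec n)} (hE : IsOpen E)
    (hCE : safeSet f H α r ⊆ E) (hk : ∀ x ∈ E, k x ∈ admissibleInputs f g H α r αr x) :
    IsForwardInvariantFor (closedLoop f g k) (safeSet f H α r) := by
  intro T x hx0 hx
  have hneg : ∀ φ : ℝ → ℝ, IsExtendedClassK φ → ∀ l < 0, φ l < 0 := fun φ hφ l hl => by
    rw [← hφ.map_zero]; exact hφ.strictMono hl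
  refine mem_of_local_invariance (isClosed_safeSet hs fun i hi =>
    continuous_matrix fun a b => (hΨ i hi a b).continuous) hE hCE
    (fun t ht => (hx t ht).continuousWithinAt) hx0 fun τ hτ hEτ => ?_
  have hderiv : ∀ i ≤ r, ∀ t ∈ Set.Icc 0 τ, ∀ a b, HasDerivWithinAt
      (fun s => barrierSeq f H α i (x s) a b)
      (matLie (closedLoop f g k) (barrierSeq f H α i) (x t) a b) (Set.Icc 0 τ) t := by
    intro i hi t ht a b
    have hsub : Set.Icc 0 τ ⊆ Set.Icc 0 T := Set.Icc_subset_Icc_right hτ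
    exact hasDerivWithinAt_comp_apply (hΨ i hi) ((hx t (hsub ht)).mono hsub) a b
  -- Induction on the distance `d` from the top level: positivity of `Ψ_{i+1}` is the differential
  -- inequality for `Ψ_i`.
  have key : ∀ d i, 1 ≤ i → i + d = r → ∀ t ∈ Set.Icc 0 τ,
      (barrierSeq f H α i (x t)).PosSemidef := by
    intro d
    induction d with
    | zero =>
      rintro i hi rfl
      refine posSemidef_of_differential_inequality (hneg αr hαr) (fun t => hs i (x t))
        (hderiv i le_rfl) (hx0 i hi le_rfl) fun t ht => ?_
      have := hk _ (hEτ t ht)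
      rw [admissibleInputs, Set.mem_ofPred_eq, sub_neg_eq_add] at this
      rw [matLie_closedLoop]
      exact this
    | succ d ih =>
      intro i hi hir
      refine posSemidef_of_differential_inequality (hneg _ (hα i hi (by omega)))
        (fun t => hs i (x t)) (hderiv i (by omega)) (hx0 i hi (by omega)) fun t ht => ?_
      have := ih (i + 1) (by omega) (by omega) t ht
      rw [barrierSeq_succ f H α hi] at this
      rw [matLie_closedLoop]
      simpa [hr.lower i hi (by omega)] using this
  exact fun t ht i hi hir => key (r - i) i hi (by omega) t ht

end

/-! ### Projection onto a moving convex set -/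

theorem Convex.existsUnique_norm_sub_sq_le {V : Type*} [NormedAddCommGroup V]
    [InnerProductSpace ℝ V] [ProperSpace V] {K : Set V} (hc : Convex ℝ K) (hcl : IsClosed K)
    (hne : K.Nonempty) (c : V) :
    ∃! u, u ∈ K ∧ ∀ w ∈ K, ‖u - c‖ ^ 2 ≤ ‖w - c‖ ^ 2 := by
  obtain ⟨u, hu, hmin⟩ := hcl.exists_infDist_eq_dist hne c
  have hmin' : ∀ w ∈ K, ‖u - c‖ ^ 2 ≤ ‖w - c‖ ^ 2 := fun w hw => by
    have := Metric.infDist_le_dist_of_mem (x := c) hw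
    rw [hmin, dist_comm, dist_comm c, dist_eq_norm, dist_eq_norm] at this
    gcongr
  refine ⟨u, ⟨hu, hmin'⟩, ?_⟩
  rintro v ⟨hv, hvmin⟩
  have h1 := hmin' _ (hc hu hv (a := 1 / 2) (b := 1 / 2) (by norm_num) (by norm_num) (by norm_num))
  have h2 := hvmin u hu
  have h3 := parallelogram_law_with_norm ℝ (u - c) (v - c)
  have e1 : (1 / 2 : ℝ) • u + (1 / 2 : ℝ) • v - c = (1 / 2 : ℝ) • ((u - c) + (v - c)) := by
    module
  have e2 : u - c - (v - c) = u - v := by abel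
  rw [e1, norm_smul, mul_pow] at h1
  rw [e2] at h3
  have e3 : ‖(1 / 2 : ℝ)‖ ^ 2 = 1 / 4 := by norm_num
  rw [e3] at h1
  have h4 : ‖u - v‖ = 0 := by
    have : ‖u - v‖ * ‖u - v‖ ≤ 0 := by nlinarith
    nlinarith [norm_nonneg (u - v)]
  exact (sub_eq_zero.1 (norm_eq_zero.1 h4)).symm

/-- Minimizers stay bounded near `x₀`, so it suffices to identify cluster points. The closed graph
makes these feasible; comparison with points that stay feasible nearby passes to the limit, density
extends it to all of `K x₀`, and uniqueness concludes. -/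
theorem continuousOn_of_isMinOn_norm_sub {X V : Type*} [TopologicalSpace X] [NormedAddCommGroup V]
    [InnerProductSpace ℝ V] [ProperSpace V] {K : X → Set V} {E : Set X} {c k : X → V}
    (hgraph : IsClosed {q : X × V | q.2 ∈ K q.1}) (hconv : ∀ x, Convex ℝ (K x))
    (hslater : ∀ x ∈ E, ∀ u ∈ K x, u ∈ closure {w | ∀ᶠ y in nhds x, w ∈ K y})
    (hc : Continuous c)
    (hk : ∀ x ∈ E, k x ∈ K x ∧ ∀ w ∈ K x, ‖k x - c x‖ ^ 2 ≤ ‖w - c x‖ ^ 2) :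
    ContinuousOn k E := by
  intro x₀ hx₀
  have hle : ∀ x ∈ E, ∀ w ∈ K x, ‖k x - c x‖ ≤ ‖w - c x‖ := fun x hx w hw =>
    le_of_sq_le_sq ((hk x hx).2 w hw) (norm_nonneg _)
  have hclK : IsClosed (K x₀) := hgraph.preimage (f := fun w : V => (x₀, w)) (by fun_prop)
  have hbound : ∀ w ∈ {w | ∀ᶠ y in nhds x₀, w ∈ K y}, ∀ᶠ y in nhdsWithin x₀ E,
      ‖k y - c y‖ ≤ ‖w - c y‖ := by
    intro w hw
    filter_upwards [self_mem_nhdsWithin, mem_nhdsWithin_of_mem_nhds hw] with y hy hwy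
    exact hle y hy w hwy
  obtain ⟨w₀, hw₀⟩ : {w | ∀ᶠ y in nhds x₀, w ∈ K y}.Nonempty :=
    closure_nonempty_iff.1 ⟨_, hslater x₀ hx₀ _ (hk x₀ hx₀).1⟩
  set R := ‖w₀ - c x₀‖ + ‖c x₀‖ + 1 with hR
  have hRb : ∀ᶠ y in nhdsWithin x₀ E, k y ∈ Metric.closedBall (0 : V) R := by
    have h1 : ∀ᶠ y in nhds x₀, ‖w₀ - c y‖ + ‖c y‖ < R := by
      have : Continuous fun y => ‖w₀ - c y‖ + ‖c y‖ := by fun_prop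
      exact this.continuousAt.eventually_lt continuousAt_const (lt_add_one _)
    filter_upwards [hbound w₀ hw₀, mem_nhdsWithin_of_mem_nhds h1] with y h2 h3
    rw [mem_closedBall_zero_iff]
    have := norm_sub_norm_le (k y) (c y)
    linarith
  refine (isCompact_closedBall (0 : V) R).tendsto_nhds_of_unique_mapClusterPt hRb fun u _ hu => ?_
  have hpair : MapClusterPt (x₀, u) (nhdsWithin x₀ E) fun y => (y, k y) := by
    have := hu
    rw [mapClusterPt_iff_ultrafilter] at this ⊢
    obtain ⟨U, hU, hUk⟩ := this
    refine ⟨U, hU, ?_⟩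
    rw [nhds_prod_eq]
    exact (Filter.Tendsto.mono_left Filter.tendsto_id (hU.trans nhdsWithin_le_nhds)).prodMk hUk
  have huK : u ∈ K x₀ := by
    refine hgraph.mem_of_mapClusterPt (l := (x₀, u)) hpair ?_
    filter_upwards [self_mem_nhdsWithin] with y hy
    exact (hk y hy).1
  have hule : ∀ w ∈ {w | ∀ᶠ y in nhds x₀, w ∈ K y}, ‖u - c x₀‖ ≤ ‖w - c x₀‖ := by
    intro w hw
    have hcl : IsClosed {q : X × V | ‖q.2 - c q.1‖ ≤ ‖w - c q.1‖} :=
      isClosed_le (by fun_prop) (by fun_prop)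
    exact hcl.mem_of_mapClusterPt (l := (x₀, u)) hpair (hbound w hw)
  have hcl2 : IsClosed {w : V | ‖u - c x₀‖ ≤ ‖w - c x₀‖} := isClosed_le (by fun_prop) (by fun_prop)
  have hall : ∀ w ∈ K x₀, ‖u - c x₀‖ ≤ ‖w - c x₀‖ := fun w hw =>
    closure_minimal hule hcl2 (hslater x₀ hx₀ w hw)
  refine ((hconv x₀).existsUnique_norm_sub_sq_le hclK ⟨u, huK⟩ (c x₀)).unique
    ⟨huK, fun w hw => ?_⟩ (hk x₀ hx₀)
  have := hall w hw
  gcongr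

/-! ### Slater's condition and the main theorem -/

theorem eventually_posDef {X : Type*} [TopologicalSpace X] {p : ℕ} {A : X → Mat p}
    (hA : Continuous A) (hs : ∀ x, (A x).IsSymm) {x₀ : X} (h : (A x₀).PosDef) :
    ∀ᶠ x in nhds x₀, (A x).PosDef := by
  have : ∀ᶠ x in nhds x₀, ∀ v ∈ Metric.sphere (0 : Vec p) 1, 0 < quadVal (A x) v := by
    refine (isCompact_sphere (0 : Vec p) 1).eventually_forall_of_forall_eventually fun v hv => ?_
    have hc : Continuous fun q : X × Vec p => quadVal (A q.1) q.2 :=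
      continuous_quadVal.comp ((hA.comp continuous_fst).prodMk continuous_snd)
    exact continuousAt_const.eventually_lt hc.continuousAt ((posDef_iff_quadVal (hs x₀)).1 h v hv)
  exact this.mono fun x hx => (posDef_iff_quadVal (hs x)).2 hx

theorem barrierDot_convexCombination {n m p : ℕ} (f : Vec n → Vec n)
    (g : Vec n → Matrix (Fin n) (Fin m) ℝ) (H : Vec n → Mat p) (α : ℕ → ℝ → ℝ) (r : ℕ) (x : Vec n)
    (u w : Vec m) (S : Mat p) {a b : ℝ} (hab : a + b = 1) :
    barrierDot f g H α r x (a • u + b • w) - S =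
      a • (barrierDot f g H α r x u - S) + b • (barrierDot f g H α r x w - S) := by
  obtain rfl : a = 1 - b := by linarith
  have : ∀ q : Vec m, ∑ j, q j • matLie (ctrlCol g j) (barrierSeq f H α r) x =
      Fintype.linearCombination ℝ (fun j => matLie (ctrlCol g j) (barrierSeq f H α r) x) q.ofLp :=
    fun q => rfl
  unfold barrierDot
  rw [this, this, this, WithLp.ofLp_add, WithLp.ofLp_smul, WithLp.ofLp_smul, map_add, map_smul,
    map_smul]
  module

theorem mainTheorem3 {n m p : ℕ} (f : Vec n → Vec n) (g : Vec n → Matrix (Fin n) (Fin m) ℝ)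
    (hf : ContDiff ℝ ∞ f) (hg : ∀ i j, ContDiff ℝ ∞ (fun x => g x i j))
    (H : Vec n → Mat p) (hH : ∀ a b, ContDiff ℝ ∞ (fun x => H x a b))
    (hHsymm : ∀ x, (H x).IsSymm)
    (r : ℕ) (α : ℕ → ℝ → ℝ)
    (hα : ∀ i, 1 ≤ i → i < r → IsExtendedClassK (α i) ∧ ContDiff ℝ ∞ (α i))
    (hr : IsFirstInputLevel f g H α r)
    (αr : ℝ → ℝ) (hCBF : IsHOMCBFWith f g H α r αr) :
    (∀ k : Vec n → Vec m, Continuous k →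
      (∃ E : Set (Vec n), IsOpen E ∧ safeSet f H α r ⊆ E ∧
        ∀ x ∈ E, k x ∈ admissibleInputs f g H α r αr x) →
      IsForwardInvariantFor (closedLoop f g k) (safeSet f H α r)) ∧
    (∀ knom : Vec n → Vec m, Continuous knom →
      ∃ E : Set (Vec n), IsOpen E ∧ safeSet f H α r ⊆ E ∧
        (∀ x ∈ E, ∃! u, IsSDPSolution f g H α r αr knom x u) ∧
        ∀ k : Vec n → Vec m, (∀ x ∈ E, IsSDPSolution f g H α r αr knom x (k x)) →
          ContinuousOn k E ∧
          IsForwardInvariantFor (closedLoop f g k) (safeSet f H α r)) := by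
  have hs : ∀ i x, (barrierSeq f H α i x).IsSymm := barrierSeq_isSymm hHsymm α
  have hΨ : ∀ i ≤ r, ∀ a b, ContDiff ℝ ∞ fun x => barrierSeq f H α i x a b :=
    contDiff_barrierSeq hf hH hHsymm fun i h1 h2 => (hα i h1 h2).2
  have hinv : ∀ (k : Vec n → Vec m) (E : Set (Vec n)), IsOpen E → safeSet f H α r ⊆ E →
      (∀ x ∈ E, k x ∈ admissibleInputs f g H α r αr x) →
      IsForwardInvariantFor (closedLoop f g k) (safeSet f H α r) := fun k E hE hCE hk =>
    isForwardInvariantFor_safeSet hs hΨ (fun i h1 h2 => (hα i h1 h2).1) hCBF.classK hr hE hCE hk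
  refine ⟨fun k _ ⟨E, hE, hCE, hk⟩ => hinv k E hE hCE hk, fun knom hknom => ?_⟩
  set F : Vec n × Vec m → Mat p := fun q =>
    barrierDot f g H α r q.1 q.2 - -spectralMap αr (barrierSeq f H α r q.1) with hF
  have hFc : Continuous F := by
    have h1 := continuous_barrierDot hf hg (hΨ r le_rfl)
    have h2 := continuous_spectralMap
      (continuous_matrix fun a b => (hΨ r le_rfl a b).continuous) (hs r) hCBF.classK.continuous
    exact h1.sub (h2.comp continuous_fst).neg
  have hFs : ∀ q, (F q).IsSymm := by
    rintro ⟨x, u⟩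
    have hsum : (∑ j, u j • matLie (ctrlCol g j) (barrierSeq f H α r) x).IsSymm := by
      refine Finset.sum_induction _ Matrix.IsSymm (fun _ _ h1 h2 => h1.add h2)
        Matrix.isSymm_zero fun j _ => (matLie_isSymm (hs r) x).smul _
    exact ((matLie_isSymm (hs r) x).add hsum).sub (spectralMap_isSymm (hs r x) αr).neg
  have hadm : ∀ x u, u ∈ admissibleInputs f g H α r αr x ↔ (F (x, u)).PosSemidef :=
    fun x u => Iff.rfl
  have hcomb : ∀ x (u w : Vec m) (a b : ℝ), a + b = 1 →
      F (x, a • u + b • w) = a • F (x, u) + b • F (x, w) := fun x u w a b hab =>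
    barrierDot_convexCombination f g H α r x u w _ hab
  have hconv : ∀ x, Convex ℝ (admissibleInputs f g H α r αr x) := by
    intro x u hu w hw a b ha hb hab
    rw [hadm] at hu hw ⊢
    rw [hcomb x u w a b hab]
    exact (hu.smul ha).add (hw.smul hb)
  have hgraph : IsClosed {q : Vec n × Vec m | q.2 ∈ admissibleInputs f g H α r αr q.1} := by
    have : {q : Vec n × Vec m | q.2 ∈ admissibleInputs f g H α r αr q.1} =
        ⋂ v, {q | 0 ≤ quadVal (F q) v} := by
      ext q
      simp [hadm, posSemidef_iff_quadVal (hFs _)]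
    rw [this]
    exact isClosed_iInter fun v => isClosed_le continuous_const
      (continuous_quadVal.comp (hFc.prodMk continuous_const))
  have hev : ∀ x u, (F (x, u)).PosDef → ∀ᶠ y in nhds x, (F (y, u)).PosDef := fun x u h =>
    eventually_posDef (A := fun y => F (y, u)) (by fun_prop) (fun y => hFs _) h
  -- Strict feasibility is an open condition on the state, holds on the safe set, and is Slater's
  -- condition for the SDP.
  set E : Set (Vec n) := {x | ∃ u, (F (x, u)).PosDef} with hEdef
  have hE : IsOpen E := isOpen_iff_mem_nhds.2 fun x ⟨u, hu⟩ =>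
    (hev x u hu).mono fun y hy => ⟨u, hy⟩
  have hCE : safeSet f H α r ⊆ E := fun x hx => hCBF.strict x hx
  have hslater : ∀ x ∈ E, ∀ u ∈ admissibleInputs f g H α r αr x,
      u ∈ closure {w | ∀ᶠ y in nhds x, w ∈ admissibleInputs f g H α r αr y} := by
    rintro x ⟨w, hw⟩ u hu
    -- Moving `u` slightly toward the strictly feasible `w` makes it strictly feasible, hence
    -- feasible at all nearby states.
    have hlim : Filter.Tendsto (fun b : ℝ => (1 - b) • u + b • w) (nhdsWithin 0 (Set.Ioi 0))
        (nhds u) := by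
      have : Continuous fun b : ℝ => (1 - b) • u + b • w := by fun_prop
      simpa using (this.tendsto 0).mono_left nhdsWithin_le_nhds
    refine mem_closure_of_tendsto hlim ?_
    filter_upwards [Ioo_mem_nhdsGT (zero_lt_one (α := ℝ))] with b hb
    have hpd : (F (x, (1 - b) • u + b • w)).PosDef := by
      rw [hcomb x u w _ _ (by ring)]
      exact Matrix.PosDef.posSemidef_add (((hadm x u).1 hu).smul (by linarith [hb.2]))
        (hw.smul hb.1)
    exact (hev x _ hpd).mono fun y hy => (hadm y _).2 hy.posSemidef
  refine ⟨E, hE, hCE, fun x hx => ?_, fun k hk => ⟨?_, hinv k E hE hCE fun x hx => (hk x hx).1⟩⟩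
  · obtain ⟨w, hw⟩ := hx
    exact (hconv x).existsUnique_norm_sub_sq_le
      (hgraph.preimage (f := fun u : Vec m => (x, u)) (by fun_prop))
      ⟨w, (hadm x w).2 hw.posSemidef⟩ (knom x)
  · exact continuousOn_of_isMinOn_norm_sub hgraph hconv hslater hknom hk
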